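/- Let $F$ be a field of characteristic zero and let $E$ be the (unital) Grassmann algebra of an $F$-vector space $L$ with a countably infinite basis $e_1,e_2,\ldots$. Let $G$ be an abelian group, written multiplicatively, and $H\leq G$. Let $E=\bigoplus_{g\in G}A_g$ be an $H$-central $G$-grading, that is, a $G$-grading such that every $e_i$ is homogeneous, $A_g\neq 0$ for every $g\in G$, and for every $h\in H$ the component $A_h$ contains infinitely many monomials $e_{i_1}\cdots e_{i_k}$ of even length $k$ with pairwise disjoint supports $\{e_{i_1},\ldots,e_{i_k}\}$. Let $B=\bigoplus_{\overline g\in G/H}A_{\overline g}$, with $A_{\overline g}=\bigoplus_{h\in H}A_{gh}$, be $E$ with the induced $G/H$-grading. For a group $K$, let $F\langle X|K\rangle$ be the free associative unital algebra on the variables $x_i^{k}$ of degree $k$ ($k\in K$, $i\in\mathbb{N}$), and for a $K$-graded algebra $C=\bigoplus_{k\in K}C_k$ let $T_K(C)$ be its ideal of $K$-graded identities, that is, the set of all $f\in F\langle X|K\rangle$ that vanish whenever each variable $x_i^k$ is replaced by an element of $C_k$. Put $I=T_{G/H}(B)$. (1) There is an injective map from the variables of $F\langle X|G\rangle$ to the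 variables of $F\langle X|G/H\rangle$ that sends each variable of degree $g$ to a variable of degree $\overline g$. For each such injective map, if $\pi\colon F\langle X|G\rangle\to F\langle X|G/H\rangle$ denotes the homomorphism of algebras that extends it, then \[T_G(E)=\{f\in F\langle X|G\rangle\mid \pi(f)\in I\}.\] (2) Let $\pi_H\colon F\langle X|G\rangle\to F\langle X|G/H\rangle$ be the homomorphism with $\pi_H(x_i^g)=x_i^{\overline g}$. Then $\pi_H(f)\in I$ for every $f\in T_G(E)$. If $V$ is a set of variables on which $\pi_H$ is injective and $f$ is a polynomial in variables from $V$, then $f\in T_G(E)$ if and only if $\pi_H(f)\in I$. -/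

import Mathlib

/-- The Grassmann algebra `E` of a vector space with countably infinite basis `e₀, e₁, …`. -/
abbrev Grassmann (F : Type*) [Field F] : Type _ := ExteriorAlgebra F (ℕ →₀ F)

namespace Grassmann

/-- The generator `e i` of the Grassmann algebra. -/
noncomputable def e (F : Type*) [Field F] (i : ℕ) : Grassmann F :=
  ExteriorAlgebra.ι F (Finsupp.single i (1 : F))

/-- The monomial `e_{i₁} ⋯ e_{iₖ}` with support `s = {i₁ < ⋯ < iₖ}`; its length is `s.card`. -/
noncomputable def monomial (F : Type*) [Field F] (s : Finset ℕ) : Grassmann F :=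
  ((s.sort (· ≤ ·)).map (e F)).prod

/-- A `G`-grading `𝒜` of the Grassmann algebra is `H`-central if every generator is homogeneous,
the support is all of `G`, and for every `h ∈ H` the component `𝒜 h` contains infinitely many
monomials of even length with pairwise disjoint supports. -/
structure IsCentralGrading {F G : Type*} [Field F] [AddCommGroup G] [DecidableEq G]
    (H : AddSubgroup G) (𝒜 : G → Submodule F (Grassmann F)) [GradedAlgebra 𝒜] : Prop where
  homogeneous : ∀ i : ℕ, SetLike.IsHomogeneousElem 𝒜 (e F i)
  fullSupport : ∀ g : G, 𝒜 g ≠ ⊥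
  central : ∀ h ∈ H, ∃ S : Set (Finset ℕ), S.Infinite ∧
    (∀ s ∈ S, Even s.card ∧ monomial F s ∈ 𝒜 h) ∧ S.PairwiseDisjoint id

end Grassmann

/-- The free associative unital algebra `F⟨X | G⟩`: the generator `(g, i)` is the variable
`x_i^g`, of degree `g`. -/
abbrev FreeGradedAlgebra (F G : Type*) [Field F] : Type _ := FreeAlgebra F (G × ℕ)

/-- The set `T_G(A)` of `G`-graded polynomial identities of an algebra `A` with components
`𝒜 g`: the polynomials which vanish under all substitutions `x_i^g ↦ a (g, i) ∈ 𝒜 g`. -/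
def gradedIdentities {F G A : Type*} [Field F] [Ring A] [Algebra F A]
    (𝒜 : G → Submodule F A) : Set (FreeGradedAlgebra F G) :=
  {f | ∀ a : G × ℕ → A, (∀ v : G × ℕ, a v ∈ 𝒜 v.1) → FreeAlgebra.lift F a f = 0}

/-- The induced `G ⧸ H`-grading: the component of a coset is the sum of the components of its
elements. -/
def quotientGrading {F G A : Type*} [Field F] [AddCommGroup G] [Ring A] [Algebra F A]
    (H : AddSubgroup G) (𝒜 : G → Submodule F A) (q : G ⧸ H) : Submodule F A :=
  ⨆ (g : G) (_ : (g : G ⧸ H) = q), 𝒜 g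

/-- The effect on variables of the projection to `F⟨X | G ⧸ H⟩`: the variable `x_i^g` goes to the
variable of degree `g + H` whose index is `σ (g, i)`. -/
def projVar {G : Type*} [AddCommGroup G] (H : AddSubgroup G) (σ : G × ℕ → ℕ) (v : G × ℕ) :
    (G ⧸ H) × ℕ :=
  ((v.1 : G ⧸ H), σ v)

/-- The homomorphism `F⟨X | G⟩ → F⟨X | G ⧸ H⟩` that acts on the variables by `projVar H σ`. With
`σ = Prod.snd` it is `x_i^g ↦ x_i^{g + H}`. -/
noncomputable def proj {F G : Type*} [Field F] [AddCommGroup G] (H : AddSubgroup G)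
    (σ : G × ℕ → ℕ) : FreeGradedAlgebra F G →ₐ[F] FreeGradedAlgebra F (G ⧸ H) :=
  FreeAlgebra.lift F fun v => FreeAlgebra.ι F (projVar H σ v)

/-! The main point is that a graded identity `f` vanishes on substitutions homogeneous only modulo
`H`. Such a substitution involves finitely many `h ∈ H`, which are removed one at a time. Write it
as `a + b`, with `b` the part shifted by `h₀`, and let `w` be a sum of even, hence central,
monomials of degree `-h₀`. Then `b * w` has the unshifted degrees, so `f(a + b * w) = 0` by
induction on the number of shifts. This is a polynomial in the central element `w`; vanishing for
all such `w` forces its coefficients to be zero (`polynomial_eq_zero`), and `w = 1` gives `f(a + b)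
= 0`.

The converse only transports substitutions along an injective renaming of variables. Such a renaming
exists because `G` is countable, the Grassmann algebra having countable dimension. -/

namespace Grassmann

/-! ### Contractions and even monomials -/

variable {F : Type*} [Field F]

/-- The right contraction by the `i`-th coordinate form. -/
noncomputable def contract (F : Type*) [Field F] (i : ℕ) : Grassmann F →ₗ[F] Grassmann F :=
  (CliffordAlgebra.contractRight (Q := (0 : QuadraticForm F (ℕ →₀ F)))).flip (Finsupp.lapply i)

theorem contract_mul_ι (i : ℕ) (x : Grassmann F) (m : ℕ →₀ F) :
    contract F i (x * ExteriorAlgebra.ι F m) =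
      m i • x - contract F i x * ExteriorAlgebra.ι F m :=
  CliffordAlgebra.contractRight_mul_ι (Q := (0 : QuadraticForm F (ℕ →₀ F)))
    (d := Finsupp.lapply i) m x

theorem contract_algebraMap (i : ℕ) (r : F) :
    contract F i (algebraMap F (Grassmann F) r) = 0 :=
  CliffordAlgebra.contractRight_algebraMap (0 : QuadraticForm F (ℕ →₀ F)) (Finsupp.lapply i) r

/-- Vanishing contractions serve as the notion of not depending on a generator. -/
theorem exists_finset_contract_eq_zero (x : Grassmann F) :
    ∃ R : Finset ℕ, ∀ i ∉ R, contract F i x = 0 := by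
  induction x using CliffordAlgebra.right_induction with
  | algebraMap r => exact ⟨∅, fun i _ => contract_algebraMap i r⟩
  | add x y hx hy =>
    obtain ⟨R, hR⟩ := hx
    obtain ⟨R', hR'⟩ := hy
    refine ⟨R ∪ R', fun i hi => ?_⟩
    rw [Finset.notMem_union] at hi
    rw [map_add, hR i hi.1, hR' i hi.2, add_zero]
  | mul_ι m x hx =>
    obtain ⟨R, hR⟩ := hx
    refine ⟨R ∪ m.support, fun i hi => ?_⟩
    rw [Finset.notMem_union, Finsupp.notMem_support_iff] at hi
    refine (contract_mul_ι i x m).trans ?_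
    rw [hR i hi.1, hi.2, zero_smul, zero_mul, sub_zero]

/-- An element is not annihilated by a product of distinct generators on which it does not
depend. -/
theorem eq_zero_of_mul_prod_eq_zero (l : List ℕ) (hl : l.Nodup) (x : Grassmann F)
    (hx : ∀ i ∈ l, contract F i x = 0) (h : x * (l.map (e F)).prod = 0) : x = 0 := by
  induction l generalizing x with
  | nil => simpa using h
  | cons j l ih =>
    rw [List.nodup_cons] at hl
    rw [List.map_cons, List.prod_cons, ← mul_assoc] at h
    have hj : x * e F j = 0 := by
      refine ih hl.2 _ (fun i hi => ?_) h
      have hij : j ≠ i := fun hij => hl.1 (hij ▸ hi)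
      rw [e, contract_mul_ι, hx i (List.mem_cons_of_mem _ hi), Finsupp.single_eq_of_ne' hij,
        zero_smul, zero_mul, sub_zero]
    -- Contracting `x * e F j = 0` by the `j`-th form returns `x`.
    have := contract_mul_ι j x (Finsupp.single j 1)
    rw [← e, hj, map_zero, hx j List.mem_cons_self, Finsupp.single_eq_same, one_smul, zero_mul,
      sub_zero] at this
    exact this.symm

theorem ι_mul_prod (l : List ℕ) (m : ℕ →₀ F) :
    ExteriorAlgebra.ι F m * (l.map (e F)).prod =
      (-1) ^ l.length * ((l.map (e F)).prod * ExteriorAlgebra.ι F m) := by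
  induction l with
  | nil => simp
  | cons j l ih =>
    have h : ExteriorAlgebra.ι F m * e F j = -(e F j * ExteriorAlgebra.ι F m) :=
      eq_neg_of_add_eq_zero_left (ExteriorAlgebra.ι_add_mul_swap m (Finsupp.single j 1))
    have hc : Commute (e F j) ((-1) ^ l.length) := ((Commute.one_right _).neg_right).pow_right _
    rw [List.map_cons, List.prod_cons, ← mul_assoc, h, neg_mul, mul_assoc, ih, ← mul_assoc,
      hc.eq, List.length_cons, pow_succ]
    simp only [mul_assoc, neg_mul, mul_neg, one_mul]

theorem commute_monomial {s : Finset ℕ} (hs : Even s.card) (x : Grassmann F) :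
    Commute x (monomial F s) := by
  induction x using ExteriorAlgebra.induction with
  | algebraMap r => exact Algebra.commutes r _
  | ι m =>
    have := ι_mul_prod (s.sort (· ≤ ·)) m
    rw [Finset.length_sort, hs.neg_one_pow, one_mul] at this
    exact this
  | mul a b ha hb => exact ha.mul_left hb
  | add a b ha hb => exact ha.add_left hb

theorem monomial_mul_self {s : Finset ℕ} (hs : Even s.card) (hne : s ≠ ∅) :
    monomial F s * monomial F s = 0 := by
  obtain ⟨j, l, hl⟩ : ∃ j l, s.sort (· ≤ ·) = j :: l := by
    cases h : s.sort (· ≤ ·) with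
    | nil => exact absurd (by rw [← s.sort_toFinset (· ≤ ·), h]; rfl) hne
    | cons j l => exact ⟨j, l, rfl⟩
  have hm : monomial F s = e F j * (l.map (e F)).prod := by
    rw [monomial, hl, List.map_cons, List.prod_cons]
  calc monomial F s * monomial F s = e F j * (monomial F s * (l.map (e F)).prod) := by
        nth_rw 1 [hm]
        rw [mul_assoc, (commute_monomial hs _).eq]
    _ = e F j * e F j * ((l.map (e F)).prod * (l.map (e F)).prod) := by
        rw [hm]; simp only [mul_assoc]
    _ = 0 := by
        have : e F j * e F j = 0 := ExteriorAlgebra.ι_sq_zero _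
        rw [this, zero_mul]

theorem prod_monomial (L : List (Finset ℕ)) :
    (L.map (monomial F)).prod =
      ((L.flatMap fun s => s.sort (· ≤ ·)).map (e F)).prod := by
  induction L with
  | nil => rfl
  | cons s L ih =>
    rw [List.map_cons, List.prod_cons, ih, List.flatMap_cons, List.map_append, List.prod_append]
    rfl

end Grassmann

/-- For `t` central with `t * t = 0`, the binomial expansion of a power of `l.sum + t` stops at the
term linear in `t`. -/
theorem List.sum_pow_of_central_of_mul_self {R : Type*} [Ring R] (l : List R)
    (hc : ∀ t ∈ l, ∀ x, Commute x t) (h0 : ∀ t ∈ l, t * t = 0) :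
    l.sum ^ l.length = (l.length.factorial : R) * l.prod ∧ l.sum ^ (l.length + 1) = 0 := by
  induction l with
  | nil => simp
  | cons t l ih =>
    obtain ⟨h1, h2⟩ := ih (fun t ht => hc t (List.mem_cons_of_mem _ ht))
      (fun t ht => h0 t (List.mem_cons_of_mem _ ht))
    have ht := hc t List.mem_cons_self
    have htt := h0 t List.mem_cons_self
    have key : ∀ n : ℕ, (l.sum + t) ^ (n + 1) =
        l.sum ^ (n + 1) + (n + 1 : ℕ) * (l.sum ^ n * t) := by
      intro n
      induction n with
      | zero => simp
      | succ n ihn =>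
        have h3 : l.sum ^ n * t * t = 0 := by rw [mul_assoc, htt, mul_zero]
        have h4 : l.sum ^ n * t * l.sum = l.sum ^ (n + 1) * t := by
          rw [mul_assoc, ← (ht l.sum).eq, ← mul_assoc, pow_succ]
        rw [pow_succ, ihn, mul_add, add_mul, add_mul, mul_assoc _ _ t, h3, mul_zero, add_zero,
          mul_assoc _ _ l.sum, h4, ← pow_succ, add_assoc, ← add_one_mul]
        norm_cast
    rw [List.sum_cons, List.prod_cons, List.length_cons, add_comm t]
    constructor
    · rw [key, h2, zero_add, h1, Nat.factorial_succ, Nat.cast_mul, mul_assoc, mul_assoc,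
        (ht l.prod).eq]
    · rw [key, h2, zero_mul, mul_zero, add_zero, pow_succ, h2, zero_mul]

/-- Each member of `S` that meets `R` picks a point of `R`; disjointness makes the picks distinct.
-/
theorem Set.PairwiseDisjoint.finite_not_disjoint {α : Type*} {S : Set (Finset α)}
    (hS : S.PairwiseDisjoint id) (R : Finset α) : {s ∈ S | ¬ Disjoint s R}.Finite := by
  have hex : ∀ s : Finset α, ¬ Disjoint s R → ∃ i ∈ s, i ∈ R := fun s hs =>
    Finset.not_disjoint_iff.1 hs
  rcases Set.eq_empty_or_nonempty {s ∈ S | ¬ Disjoint s R} with h | ⟨s₀, -, hs₀⟩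
  · rw [h]; exact Set.finite_empty
  obtain ⟨i₀, -⟩ := hex s₀ hs₀
  have : Nonempty α := ⟨i₀⟩
  choose! φ hφ hφR using hex
  refine Set.Finite.of_injOn (f := φ) (t := (R : Set α)) (fun s hs => hφR s hs.2) ?_
    R.finite_toSet
  intro s hs s' hs' hss
  by_contra hne
  exact Finset.disjoint_left.1 (hS hs.1 hs'.1 hne) (hφ s hs.2) (hss ▸ hφ s' hs'.2)

/-! ### Polynomials in a central element -/

namespace Grassmann

variable {F : Type*} [Field F] [CharZero F]

/-- A polynomial over the Grassmann algebra that vanishes on all sums of monomials from an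
infinite disjoint family of even monomials is zero. -/
theorem polynomial_eq_zero {S : Set (Finset ℕ)} (hinf : S.Infinite)
    (heven : ∀ s ∈ S, Even s.card) (hdisj : S.PairwiseDisjoint id)
    (p : Polynomial (Grassmann F))
    (hp : ∀ L : List (Finset ℕ), (∀ s ∈ L, s ∈ S) → p.eval (L.map (monomial F)).sum = 0) :
    p = 0 := by
  ext k
  rw [Polynomial.coeff_zero]
  induction k using Nat.strong_induction_on with
  | _ k ih =>
  obtain ⟨R, hR⟩ := exists_finset_contract_eq_zero (p.coeff k)
  -- The empty monomial is `1`, which does not square to zero, so it is excluded too.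
  have hfin : ({s ∈ S | ¬ Disjoint s R} ∪ {∅}).Finite :=
    (hdisj.finite_not_disjoint R).union (Set.finite_singleton _)
  obtain ⟨U, hU, hcard⟩ := (hinf.sdiff hfin).exists_subset_card_eq k
  have hUS : ∀ s ∈ U.toList, s ∈ S := fun s hs => (hU (Finset.mem_toList.1 hs)).1
  have hUne : ∀ s ∈ U.toList, s ≠ ∅ := fun s hs h =>
    (hU (Finset.mem_toList.1 hs)).2 (Or.inr h)
  have hUR : ∀ s ∈ U.toList, Disjoint s R := fun s hs => by
    by_contra h
    exact (hU (Finset.mem_toList.1 hs)).2 (Or.inl ⟨hUS s hs, h⟩)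
  have hpow := List.sum_pow_of_central_of_mul_self (U.toList.map (monomial F))
    (by
      simp only [List.mem_map, forall_exists_index, and_imp, forall_apply_eq_imp_iff₂]
      exact fun s hs => commute_monomial (heven s (hUS s hs)))
    (by
      simp only [List.mem_map, forall_exists_index, and_imp, forall_apply_eq_imp_iff₂]
      exact fun s hs => monomial_mul_self (heven s (hUS s hs)) (hUne s hs))
  rw [List.length_map, Finset.length_toList, hcard, prod_monomial] at hpow
  have heval := hp U.toList hUS
  -- For a sum `w` of `k` monomials, terms below `k` vanish by induction and those above because `w
  -- ^ (k + 1) = 0`. What remains is `k!` times the `k`-th coefficient times a product of distinct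
  -- generators on which it does not depend.
  rw [Polynomial.eval_eq_sum_range, Finset.sum_eq_single k] at heval
  · rw [hpow.1, ← mul_assoc, ← (Nat.cast_commute _ _).eq, mul_assoc, ← nsmul_eq_mul,
      ← Nat.cast_smul_eq_nsmul F, smul_eq_zero] at heval
    refine eq_zero_of_mul_prod_eq_zero _ ?_ _ ?_
      (heval.resolve_left (Nat.cast_ne_zero.2 k.factorial_ne_zero))
    · rw [List.nodup_flatMap]
      refine ⟨fun s _ => s.sort_nodup _, ?_⟩
      refine List.Nodup.pairwise_of_forall_ne U.nodup_toList fun s hs s' hs' hne => ?_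
      intro i hi hi'
      rw [Finset.mem_sort] at hi hi'
      exact Finset.disjoint_left.1 (hdisj (hUS s hs) (hUS s' hs') hne) hi hi'
    · intro i hi
      obtain ⟨s, hs, his⟩ := List.mem_flatMap.1 hi
      exact hR i (Finset.disjoint_left.1 (hUR s hs) ((Finset.mem_sort _).1 his))
  · intro j _ hj
    rcases lt_or_gt_of_ne hj with h | h
    · rw [ih j h, zero_mul]
    · obtain ⟨d, rfl⟩ := Nat.exists_eq_add_of_lt h
      rw [show k + d + 1 = k + 1 + d by ring, pow_add, hpow.2, zero_mul, mul_zero]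
  · intro h
    rw [Finset.mem_range, not_lt] at h
    rw [Polynomial.coeff_eq_zero_of_natDegree_lt h, zero_mul]

theorem lift_add_eq_zero {X : Type*} {S : Set (Finset ℕ)} (hinf : S.Infinite)
    (heven : ∀ s ∈ S, Even s.card) (hdisj : S.PairwiseDisjoint id)
    (f : FreeAlgebra F X) (a b : X → Grassmann F)
    (h : ∀ L : List (Finset ℕ), (∀ s ∈ L, s ∈ S) →
      FreeAlgebra.lift F (fun v => a v + b v * (L.map (monomial F)).sum) f = 0) :
    FreeAlgebra.lift F (fun v => a v + b v) f = 0 := by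
  let P : FreeAlgebra F X →ₐ[F] Polynomial (Grassmann F) :=
    FreeAlgebra.lift F fun v => Polynomial.C (a v) + Polynomial.C (b v) * Polynomial.X
  have heval : ∀ w : Grassmann F, (∀ x, Commute x w) →
      (P f).eval w = FreeAlgebra.lift F (fun v => a v + b v * w) f := by
    intro w hw
    have : ((Polynomial.eval₂AlgHom (AlgHom.id F (Grassmann F)) w hw).comp P) =
        FreeAlgebra.lift F (fun v => a v + b v * w) := by
      ext v
      simp [P, Polynomial.eval₂AlgHom]
    exact DFunLike.congr_fun this f
  have hP : P f = 0 := by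
    refine polynomial_eq_zero hinf heven hdisj _ fun L hL => ?_
    rw [heval, h L hL]
    intro x
    refine Commute.list_sum_right _ _ ?_
    simp only [List.mem_map, forall_exists_index, and_imp, forall_apply_eq_imp_iff₂]
    exact fun s hs => commute_monomial (heven s (hL s hs)) x
  have := heval 1 Commute.one_right
  rw [hP, Polynomial.eval_zero] at this
  simpa using this.symm

end Grassmann

theorem FreeAlgebra.exists_finset_lift_eq {F X A : Type*} [CommSemiring F] [Semiring A]
    [Algebra F A] (f : FreeAlgebra F X) :
    ∃ V : Finset X, ∀ c c' : X → A, (∀ v ∈ V, c v = c' v) →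
      FreeAlgebra.lift F c f = FreeAlgebra.lift F c' f := by
  classical
  induction f using FreeAlgebra.induction with
  | grade0 r => exact ⟨∅, fun c c' _ => by simp⟩
  | grade1 v => exact ⟨{v}, fun c c' h => by simpa using h⟩
  | mul x y hx hy =>
    obtain ⟨V, hV⟩ := hx
    obtain ⟨V', hV'⟩ := hy
    refine ⟨V ∪ V', fun c c' h => ?_⟩
    rw [map_mul, map_mul, hV c c' fun v hv => h v (Finset.mem_union_left _ hv),
      hV' c c' fun v hv => h v (Finset.mem_union_right _ hv)]
  | add x y hx hy =>
    obtain ⟨V, hV⟩ := hx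
    obtain ⟨V', hV'⟩ := hy
    refine ⟨V ∪ V', fun c c' h => ?_⟩
    rw [map_add, map_add, hV c c' fun v hv => h v (Finset.mem_union_left _ hv),
      hV' c c' fun v hv => h v (Finset.mem_union_right _ hv)]

theorem exists_finset_mem_of_mem_quotientGrading {F G A : Type*} [Field F] [AddCommGroup G]
    [Ring A] [Algebra F A] {H : AddSubgroup G} {𝒜 : G → Submodule F A} (g : G) {x : A}
    (hx : x ∈ quotientGrading H 𝒜 (g : G ⧸ H)) :
    ∃ T : Finset H, x ∈ ⨆ h ∈ T, 𝒜 (g + h) := by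
  rw [← Submodule.mem_iSup_iff_exists_finset]
  refine (iSup₂_le fun g' hg' => ?_ : quotientGrading H 𝒜 (g : G ⧸ H) ≤ _) hx
  have : -g + g' ∈ H := QuotientAddGroup.eq.1 hg'.symm
  exact (congrArg 𝒜 (by simp)).le.trans (le_iSup (fun h : H => 𝒜 (g + h)) ⟨-g + g', this⟩)

/-! ### Substitutions homogeneous modulo `H` -/

namespace Grassmann

section Identities

variable {F G : Type*} [Field F] [CharZero F] [AddCommGroup G] [DecidableEq G]
  {H : AddSubgroup G} {𝒜 : G → Submodule F (Grassmann F)} [GradedAlgebra 𝒜]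

/-- The separate summand `𝒜 v.1` absorbs `b v * w` when a shift is removed from `T`. -/
theorem IsCentralGrading.lift_eq_zero_of_mem_iSup (h𝒜 : IsCentralGrading H 𝒜)
    {f : FreeGradedAlgebra F G} (hf : f ∈ gradedIdentities 𝒜) (T : Finset H)
    (c : G × ℕ → Grassmann F) (hc : ∀ v, c v ∈ 𝒜 v.1 ⊔ ⨆ h ∈ T, 𝒜 (v.1 + h)) :
    FreeAlgebra.lift F c f = 0 := by
  classical
  induction T using Finset.induction_on generalizing c with
  | empty => exact hf c fun v => by simpa using hc v
  | insert h₀ T _ ih =>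
    have hsplit : ∀ v, ∃ a ∈ 𝒜 v.1 ⊔ ⨆ h ∈ T, 𝒜 (v.1 + h), ∃ b ∈ 𝒜 (v.1 + h₀), a + b = c v := by
      intro v
      have := hc v
      rwa [Finset.iSup_insert, sup_comm (𝒜 (v.1 + h₀)), ← sup_assoc, Submodule.mem_sup] at this
    choose a ha b hb hab using hsplit
    obtain rfl : (fun v => a v + b v) = c := funext hab
    obtain ⟨S, hinf, hS, hdisj⟩ := h𝒜.central (-h₀) (neg_mem h₀.2)
    refine lift_add_eq_zero hinf (fun s hs => (hS s hs).1) hdisj f a b fun L hL => ?_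
    refine ih _ fun v => add_mem (ha v) (Submodule.mem_sup_left ?_)
    have hw : (L.map (monomial F)).sum ∈ 𝒜 (-h₀) := by
      refine list_sum_mem ?_
      simp only [List.mem_map, forall_exists_index, and_imp, forall_apply_eq_imp_iff₂]
      exact fun s hs => (hS s (hL s hs)).2
    simpa using SetLike.mul_mem_graded (hb v) hw

/-- A graded identity of an `H`-central grading vanishes under all substitutions that respect the
degrees modulo `H`. -/
theorem IsCentralGrading.lift_eq_zero (h𝒜 : IsCentralGrading H 𝒜)
    {f : FreeGradedAlgebra F G} (hf : f ∈ gradedIdentities 𝒜)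
    (c : G × ℕ → Grassmann F) (hc : ∀ v, c v ∈ quotientGrading H 𝒜 (v.1 : G ⧸ H)) :
    FreeAlgebra.lift F c f = 0 := by
  classical
  obtain ⟨V, hV⟩ := FreeAlgebra.exists_finset_lift_eq (A := Grassmann F) f
  have hT : ∀ v : G × ℕ, ∃ T : Finset H, c v ∈ ⨆ h ∈ T, 𝒜 (v.1 + h) :=
    fun v => exists_finset_mem_of_mem_quotientGrading v.1 (hc v)
  choose T hT using hT
  -- Variables outside `V` are sent to zero, so that one finite set of shifts serves all variables.
  rw [hV c (fun v => if v ∈ V then c v else 0) fun v hv => (if_pos hv).symm]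
  refine h𝒜.lift_eq_zero_of_mem_iSup hf (V.biUnion T) _ fun v => ?_
  by_cases hv : v ∈ V
  · rw [if_pos hv]
    refine Submodule.mem_sup_right ?_
    refine (iSup₂_le fun h hh => ?_ : (⨆ h ∈ T v, 𝒜 (v.1 + h)) ≤ _) (hT v)
    exact le_iSup₂_of_le (f := fun (h : H) (_ : h ∈ V.biUnion T) => 𝒜 (v.1 + h)) h
      (Finset.mem_biUnion.2 ⟨v, hv, hh⟩) le_rfl
  · rw [if_neg hv]
    exact zero_mem _

theorem IsCentralGrading.proj_mem_gradedIdentities (h𝒜 : IsCentralGrading H 𝒜)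
    (σ : G × ℕ → ℕ) {f : FreeGradedAlgebra F G} (hf : f ∈ gradedIdentities 𝒜) :
    proj H σ f ∈ gradedIdentities (quotientGrading H 𝒜) := by
  intro b hb
  have : (FreeAlgebra.lift F b).comp (proj H σ) =
      FreeAlgebra.lift F fun v => b (projVar H σ v) := by
    ext v
    simp [proj]
  exact (DFunLike.congr_fun this f).trans (h𝒜.lift_eq_zero hf _ fun v => hb (projVar H σ v))

end Identities

theorem rank_le_aleph0 (F : Type*) [Field F] :
    Module.rank F (Grassmann F) ≤ Cardinal.aleph0 := by
  have htop : Algebra.adjoin F (Set.range (e F)) = ⊤ := by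
    rw [eq_top_iff]
    rintro x -
    induction x using ExteriorAlgebra.induction with
    | algebraMap r => exact Subalgebra.algebraMap_mem _ r
    | ι m =>
      induction m using Finsupp.induction_linear with
      | zero => rw [map_zero]; exact zero_mem _
      | add m n hm hn => rw [map_add]; exact add_mem hm hn
      | single i r =>
        rw [← mul_one r, ← smul_eq_mul, ← Finsupp.smul_single, map_smul]
        exact Subalgebra.smul_mem _ (Algebra.subset_adjoin (Set.mem_range_self i)) r
    | mul a b ha hb => exact mul_mem ha hb
    | add a b ha hb => exact add_mem ha hb
  have := Algebra.rank_adjoin_le (R := F) (Set.range (e F))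
  rw [htop, max_eq_right (Cardinal.mk_le_aleph0_iff.2 (Set.countable_range _).to_subtype)] at this
  exact (rank_top F (Grassmann F)).symm.le.trans this

/-- Nonzero elements chosen from the different components are linearly independent. -/
theorem IsCentralGrading.countable {F G : Type*} [Field F] [AddCommGroup G] [DecidableEq G]
    {H : AddSubgroup G} {𝒜 : G → Submodule F (Grassmann F)} [GradedAlgebra 𝒜]
    (h𝒜 : IsCentralGrading H 𝒜) : Countable G := by
  choose x hx hx0 using fun g => Submodule.exists_mem_ne_zero_of_ne_bot (h𝒜.fullSupport g)
  have hli := (DirectSum.Decomposition.isInternal 𝒜).submodule_iSupIndep.linearIndependent 𝒜 hx hx0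
  have := hli.cardinal_lift_le_rank.trans (Cardinal.lift_le.2 (rank_le_aleph0 F))
  rwa [Cardinal.lift_aleph0, Cardinal.lift_le_aleph0, Cardinal.mk_le_aleph0_iff] at this

end Grassmann

theorem mem_gradedIdentities_of_proj_mem {F G A : Type*} [Field F] [AddCommGroup G]
    [Ring A] [Algebra F A] {H : AddSubgroup G} {𝒜 : G → Submodule F A} {σ : G × ℕ → ℕ}
    {V : Set (G × ℕ)} (hV : Set.InjOn (projVar H σ) V) {f : FreeGradedAlgebra F G}
    (hfV : f ∈ Algebra.adjoin F (FreeAlgebra.ι F '' V))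
    (hf : proj H σ f ∈ gradedIdentities (quotientGrading H 𝒜)) : f ∈ gradedIdentities 𝒜 := by
  classical
  intro a ha
  -- The substitution `a` is carried to the images of `V`, unambiguously by injectivity there; the
  -- value `0` elsewhere lies in every component.
  let b : (G ⧸ H) × ℕ → A := fun w =>
    if h : ∃ v ∈ V, projVar H σ v = w then a h.choose else 0
  have hb : ∀ w, b w ∈ quotientGrading H 𝒜 w.1 := by
    intro w
    by_cases h : ∃ v ∈ V, projVar H σ v = w
    · simp only [b, dif_pos h]
      exact (le_iSup₂_of_le (f := fun (g : G) (_ : (g : G ⧸ H) = w.1) => 𝒜 g) h.choose.1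
        (congrArg Prod.fst h.choose_spec.2) le_rfl) (ha _)
    · simp only [b, dif_neg h]
      exact zero_mem _
  have hbV : ∀ v ∈ V, b (projVar H σ v) = a v := by
    intro v hv
    have h : ∃ u ∈ V, projVar H σ u = projVar H σ v := ⟨v, hv, rfl⟩
    simp only [b, dif_pos h]
    rw [hV h.choose_spec.1 hv h.choose_spec.2]
  have hle : Algebra.adjoin F (FreeAlgebra.ι F '' V) ≤
      AlgHom.equalizer (FreeAlgebra.lift F a) ((FreeAlgebra.lift F b).comp (proj H σ)) := by
    rw [Algebra.adjoin_le_iff]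
    rintro _ ⟨v, hv, rfl⟩
    change FreeAlgebra.lift F a (FreeAlgebra.ι F v) =
      FreeAlgebra.lift F b (proj H σ (FreeAlgebra.ι F v))
    simp [proj, hbV v hv]
  exact (hle hfV).trans (hf b hb)

theorem mainTheorem3 {F G : Type*} [Field F] [CharZero F] [AddCommGroup G] [DecidableEq G]
    (H : AddSubgroup G) (𝒜 : G → Submodule F (Grassmann F)) [GradedAlgebra 𝒜]
    (h𝒜 : Grassmann.IsCentralGrading H 𝒜) :
    -- the variables can be relabelled so that distinct ones have distinct images
    (∃ σ : G × ℕ → ℕ, Function.Injective (projVar H σ)) ∧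
    -- for every such relabelling
    (∀ σ : G × ℕ → ℕ, Function.Injective (projVar H σ) →
      gradedIdentities 𝒜 =
        {f | proj H σ f ∈ gradedIdentities (quotientGrading H 𝒜)}) ∧
    -- the map that keeps the index of each variable
    (∀ f ∈ gradedIdentities 𝒜,
      proj H Prod.snd f ∈ gradedIdentities (quotientGrading H 𝒜)) ∧
    (∀ V : Set (G × ℕ), Set.InjOn (projVar H Prod.snd) V →
      ∀ f ∈ Algebra.adjoin F (FreeAlgebra.ι F '' V),
        (f ∈ gradedIdentities 𝒜 ↔
          proj H Prod.snd f ∈ gradedIdentities (quotientGrading H 𝒜))) := by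
  refine ⟨?_, fun σ hσ => Set.Subset.antisymm
    (fun f hf => h𝒜.proj_mem_gradedIdentities σ hf) fun f hf => ?_,
    fun f hf => h𝒜.proj_mem_gradedIdentities Prod.snd hf, fun V hV f hfV =>
      ⟨fun hf => h𝒜.proj_mem_gradedIdentities Prod.snd hf,
        fun hf => mem_gradedIdentities_of_proj_mem hV hfV hf⟩⟩
  · have := h𝒜.countable
    obtain ⟨σ, hσ⟩ := exists_injective_nat (G × ℕ)
    exact ⟨σ, fun v w h => hσ (congrArg Prod.snd h)⟩
  · refine mem_gradedIdentities_of_proj_mem (V := Set.univ) hσ.injOn ?_ hf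
    rw [Set.image_univ, FreeAlgebra.adjoin_range_ι]
    exact Algebra.mem_top
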